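/- Let $n\in\mathbb N$. For a Schwartz function $u$ on $\mathbb R^n$ put $\hat u(\xi)=\mathcal Fu(\xi)=\int e^{-ix\cdot\xi}u(x)\,dx$, and extend $\mathcal F$ to $\mathcal S'(\mathbb R^n)$ by duality. For $d\in\mathbb R$ let $S^d_{1,1}(\mathbb R^n\times\mathbb R^n)$ be the set of $b\in C^\infty(\mathbb R^{2n})$ such that for all multi-indices $\alpha,\beta$ there is a constant $C_{\alpha\beta}$ with $$|D^\alpha_\xi D^\beta_x b(x,\xi)|\le C_{\alpha\beta}(1+|\xi|)^{d-|\alpha|+|\beta|}\qquad (x,\xi\in\mathbb R^n),$$ and let $S^\infty_{1,1}=\bigcup_{d\in\mathbb R}S^d_{1,1}$. For $b\in S^\infty_{1,1}$ let $\hat b=\mathcal F_{x\to\xi}b\in\mathcal S'(\mathbb R^{2n})$ denote the partial Fourier transform of $b(x,\eta)$ with respect to $x$. If $v\in\mathcal S'(\mathbb R^n)$ and $\operatorname{supp}\hat v$ is compact (that is, $v\in\mathcal F^{-1}\mathcal E'(\mathbb R^n)$), then $b(x,D)v\in\mathcal S'(\mathbb R^n)$ is defined as $c(x,D)v$, where $c(x,\xi)=b(x,\xi)\chi(\xi)$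 for any $\chi\in C^\infty_0(\mathbb R^n)$ that equals $1$ in a neighbourhood of $\operatorname{supp}\hat v$, and $c(x,D)$ is the continuous extension to $\mathcal S'(\mathbb R^n)$, given as the dual of the transposed operator on $\mathcal S(\mathbb R^n)$, of $c(x,D)u(x)=(2\pi)^{-n}\int e^{ix\cdot\xi}c(x,\xi)\hat u(\xi)\,d\xi$, $u\in\mathcal S(\mathbb R^n)$; the result does not depend on the choice of $\chi$. (The support rule.) For every $b\in S^\infty_{1,1}(\mathbb R^n\times\mathbb R^n)$ and every $v\in\mathcal F^{-1}\mathcal E'(\mathbb R^n)$, $$\operatorname{supp}\mathcal F(b(x,D)v)\subset\bigl\{\,\xi+\eta \bigm| (\xi,\eta)\in\operatorname{supp}\hat b,\ \eta\in\operatorname{supp}\hat v\,\bigr\}.$$ -/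

import Mathlib

open MeasureTheory SchwartzMap Distribution
open scoped Topology ContDiff

/-- The Euclidean space `ℝⁿ`. -/
abbrev Rn (n : ℕ) : Type := EuclideanSpace ℝ (Fin n)

noncomputable section

namespace TypeOneOne

variable {n : ℕ}

instance : (volume : Measure (Rn n × Rn n)).IsAddHaarMeasure := by
  rw [Measure.volume_eq_prod]; exact Measure.prod.instIsAddHaarMeasure _ _

instance : (volume : Measure (Rn n × Rn n)).HasTemperateGrowth :=
  Measure.IsAddHaarMeasure.instHasTemperateGrowth

/-! ### Symbols -/

/-- The coordinate directions of `ℝⁿ × ℝⁿ`: `inl i` is the direction of `x i` and `inr i` the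
direction of `ξ i`. -/
def coordDir : Fin n ⊕ Fin n → Rn n × Rn n
  | Sum.inl i => (EuclideanSpace.single i 1, 0)
  | Sum.inr i => (0, EuclideanSpace.single i 1)

/-- `b ∈ S^d_{1,1}(ℝⁿ × ℝⁿ)`: the function `b` is smooth and for every mixed partial derivative,
with `|β|` derivatives in `x` and `|α|` derivatives in `ξ`, one has
`|∂_ξ^α ∂_x^β b(x,ξ)| ≤ C (1 + |ξ|)^(d - |α| + |β|)`. A mixed partial derivative of order `m` is
given by the word `w` of the `m` coordinate directions in which one differentiates. -/
def IsSymbolOfOrder (d : ℝ) (b : Rn n × Rn n → ℂ) : Prop :=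
  ContDiff ℝ ∞ b ∧
    ∀ (m : ℕ) (w : Fin m → Fin n ⊕ Fin n), ∃ C : ℝ, ∀ x ξ : Rn n,
      ‖iteratedFDeriv ℝ m b (x, ξ) (fun i => coordDir (w i))‖ ≤
        C * (1 + ‖ξ‖) ^ (d - ({i | (w i).isRight} : Finset (Fin m)).card
          + ({i | (w i).isLeft} : Finset (Fin m)).card)

/-- `S^∞_{1,1} = ⋃_d S^d_{1,1}`. -/
def IsSymbol (b : Rn n × Rn n → ℂ) : Prop := ∃ d : ℝ, IsSymbolOfOrder d b

theorem IsSymbol.hasTemperateGrowth {b : Rn n × Rn n → ℂ} (hb : IsSymbol b) :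
    b.HasTemperateGrowth := by
  obtain ⟨d, hsm, hb⟩ := hb
  refine ⟨hsm, fun m => ?_⟩
  choose C hC using hb m
  obtain ⟨k, hk⟩ := exists_nat_ge (d + m)
  refine ⟨k, ∑ w, |C w|, fun p => ?_⟩
  refine ContinuousMultilinearMap.opNorm_le_bound (by positivity) fun v => ?_
  set c : Fin m → Fin n ⊕ Fin n → ℝ := fun i =>
    Sum.elim (fun j => (v i).1 j) (fun j => (v i).2 j) with hc
  have hv : ∀ i, v i = ∑ j, c i j • (coordDir j : Rn n × Rn n) := by
    intro i
    rw [Fintype.sum_sum_type]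
    ext j <;> simp [hc, coordDir, Prod.fst_sum, Prod.snd_sum, Pi.single_apply]
  have hcv : ∀ i j, ‖c i j‖ ≤ ‖v i‖ := by
    rintro i (j | j)
    · exact (PiLp.norm_apply_le (v i).1 j).trans (norm_fst_le _)
    · exact (PiLp.norm_apply_le (v i).2 j).trans (norm_snd_le _)
  have key : iteratedFDeriv ℝ m b p v = ∑ w : Fin m → Fin n ⊕ Fin n,
      (∏ i, c i (w i)) • iteratedFDeriv ℝ m b p (fun i => coordDir (w i)) := by
    conv_lhs => rw [show v = fun i => ∑ j, c i j • (coordDir j : Rn n × Rn n) from funext hv]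
    rw [ContinuousMultilinearMap.map_sum]
    simp_rw [ContinuousMultilinearMap.map_smul_univ]
  rw [key, Finset.sum_mul, Finset.sum_mul]
  refine (norm_sum_le _ _).trans (Finset.sum_le_sum fun w _ => ?_)
  rw [norm_smul, norm_prod, mul_comm]
  have h1 : ∏ i, ‖c i (w i)‖ ≤ ∏ i, ‖v i‖ :=
    Finset.prod_le_prod (fun _ _ => norm_nonneg _) fun i _ => hcv i _
  refine mul_le_mul ?_ h1 (Finset.prod_nonneg fun _ _ => norm_nonneg _) (by positivity)
  refine (hC w p.1 p.2).trans ?_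
  refine mul_le_mul (le_abs_self _) ?_ (by positivity) (abs_nonneg _)
  have h2 : (({i | (w i).isLeft} : Finset (Fin m)).card : ℝ) ≤ m := by
    exact_mod_cast (Finset.card_le_univ _).trans (Fintype.card_fin m).le
  calc (1 + ‖p.2‖) ^ (d - ({i | (w i).isRight} : Finset (Fin m)).card
          + ({i | (w i).isLeft} : Finset (Fin m)).card)
      ≤ (1 + ‖p.2‖) ^ (k : ℝ) := by
        apply Real.rpow_le_rpow_of_exponent_le
        · linarith [norm_nonneg p.2]
        · have : (0 : ℝ) ≤ (({i | (w i).isRight} : Finset (Fin m)).card : ℝ) := Nat.cast_nonneg _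
          linarith
    _ ≤ (1 + ‖p‖) ^ k := by
        rw [Real.rpow_natCast]
        gcongr
        exact norm_snd_le p

/-! ### The Fourier transformation, normalised as `û(ξ) = ∫ e^{-i x·ξ} u(x) dx` -/

/-- Multiplication by `(2π)⁻¹` on `ℝⁿ`. -/
def scale : Rn n ≃L[ℝ] Rn n :=
  ContinuousLinearEquiv.smulLeft (Units.mk0 ((2 * Real.pi)⁻¹) (by positivity))

/-- The Fourier transformation on Schwartz functions. Mathlib's `𝓕` has the phase `2π x·ξ`. -/
def fourierS : 𝓢(Rn n, ℂ) →L[ℂ] 𝓢(Rn n, ℂ) :=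
  compCLMOfContinuousLinearEquiv ℂ scale ∘L FourierTransform.fourierCLM ℂ 𝓢(Rn n, ℂ)

theorem scale_apply (ξ : Rn n) : scale ξ = (2 * Real.pi)⁻¹ • ξ := rfl

theorem fourier_scale {G : Type*} [NormedAddCommGroup G] [NormedSpace ℂ G]
    (u : Rn n → G) (ξ : Rn n) :
    FourierTransform.fourier u (scale ξ) =
      ∫ x, Complex.exp (-Complex.I * (inner ℝ x ξ : ℝ)) • u x := by
  rw [Real.fourier_eq']
  congr 1 with x
  congr 2
  rw [scale_apply, inner_smul_right]
  have := Real.pi_ne_zero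
  push_cast
  field_simp

theorem fourierS_apply (u : 𝓢(Rn n, ℂ)) (ξ : Rn n) :
    fourierS u ξ = ∫ x, Complex.exp (-Complex.I * (inner ℝ x ξ : ℝ)) * u x :=
  fourier_scale (u : Rn n → ℂ) ξ

/-- The Fourier transformation on tempered distributions, `⟨û, φ⟩ = ⟨u, φ̂⟩`. -/
def fourierD : 𝓢'(Rn n, ℂ) →L[ℂ] 𝓢'(Rn n, ℂ) :=
  PointwiseConvergenceCLM.precomp ℂ fourierS

/-! ### The partial Fourier transformation `F_{x → ξ}` -/

section Partial

variable {G : Type} [NormedAddCommGroup G] [NormedSpace ℂ G]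

/-- `(ξ, η) ↦ ∫ e^{-i x·ξ} f(x, η) dx`. -/
def partialFourierFun (f : Rn n × Rn n → G) (p : Rn n × Rn n) : G :=
  ∫ x, Complex.exp (-Complex.I * (inner ℝ x p.1 : ℝ)) • f (x, p.2)

theorem norm_phase (a : ℝ) : ‖Complex.exp (-Complex.I * a)‖ = 1 := by
  rw [Complex.norm_exp]; simp

theorem norm_iteratedFDeriv_slice_le (f : 𝓢(Rn n × Rn n, G)) (j : ℕ) (x η : Rn n) :
    ‖iteratedFDeriv ℝ j (fun y : Rn n => f (y, η)) x‖ ≤ ‖iteratedFDeriv ℝ j f (x, η)‖ := by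
  have h1 : (fun y : Rn n => f (y, η)) =
      (fun q => f (q + (0, η))) ∘ (ContinuousLinearMap.inl ℝ (Rn n) (Rn n)) := by
    ext y; simp
  have hs : ContDiff ℝ ∞ (fun q : Rn n × Rn n => f (q + (0, η))) :=
    (f.smooth ⊤).comp (contDiff_id.add contDiff_const)
  rw [h1, ContinuousLinearMap.iteratedFDeriv_comp_right _ hs _ (i := j) (mod_cast le_top),
    iteratedFDeriv_comp_add_right]
  refine (ContinuousMultilinearMap.norm_compContinuousLinearMap_le _ _).trans ?_
  simp only [ContinuousLinearMap.inl_apply, Prod.mk_add_mk, add_zero, zero_add]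
  refine mul_le_of_le_one_right (norm_nonneg _) ?_
  exact Finset.prod_le_one (fun _ _ => norm_nonneg _)
    fun _ _ => ContinuousLinearMap.norm_inl_le_one ℝ (Rn n) (Rn n)

theorem norm_mul_iteratedFDeriv_le (f : 𝓢(Rn n × Rn n, G)) (k j : ℕ) (x η : Rn n) :
    ‖η‖ ^ k * ‖iteratedFDeriv ℝ j f (x, η)‖ ≤ (1 + ‖x‖) ^ (-(n + 1 : ℝ)) *
      (2 ^ (k + (n + 1)) *
        (Finset.Iic (k + (n + 1), j)).sup (schwartzSeminormFamily ℂ (Rn n × Rn n) G) f) := by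
  have h := one_add_le_sup_seminorm_apply (𝕜 := ℂ) (m := (k + (n + 1), j)) le_rfl le_rfl f (x, η)
  have hx : ‖x‖ ≤ ‖(x, η)‖ := norm_fst_le (x, η)
  have hη : ‖η‖ ≤ ‖(x, η)‖ := norm_snd_le (x, η)
  have hpos : (0 : ℝ) < 1 + ‖x‖ := by positivity
  rw [Real.rpow_neg hpos.le, ← Nat.cast_add_one, Real.rpow_natCast, inv_mul_eq_div,
    le_div_iff₀ (by positivity)]
  refine le_trans ?_ h
  calc ‖η‖ ^ k * ‖iteratedFDeriv ℝ j f (x, η)‖ * (1 + ‖x‖) ^ (n + 1)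
      ≤ (1 + ‖(x, η)‖) ^ k * ‖iteratedFDeriv ℝ j f (x, η)‖ * (1 + ‖(x, η)‖) ^ (n + 1) := by
        gcongr
        linarith
    _ = _ := by rw [pow_add]; ring

theorem integrable_weight : Integrable (fun x : Rn n => (1 + ‖x‖) ^ (-(n + 1 : ℝ))) :=
  integrable_one_add_norm (by simp)

theorem integrable_slice_deriv (f : 𝓢(Rn n × Rn n, G)) (j : ℕ) (η : Rn n) :
    Integrable (fun x : Rn n => ‖iteratedFDeriv ℝ j f (x, η)‖) := by
  refine (integrable_weight.mul_const (2 ^ (0 + (n + 1)) *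
        (Finset.Iic (0 + (n + 1), j)).sup (schwartzSeminormFamily ℂ (Rn n × Rn n) G) f)).mono' ?_ ?_
  · exact (((f.smooth ⊤).continuous_iteratedFDeriv (mod_cast le_top)).norm.comp
      (by fun_prop)).aestronglyMeasurable
  · filter_upwards with x
    simpa using norm_mul_iteratedFDeriv_le f 0 j x η

/-- The slice `x ↦ f (x, η)` of a Schwartz function. -/
def slice (η : Rn n) : 𝓢(Rn n × Rn n, G) →L[ℂ] 𝓢(Rn n, G) :=
  compCLMOfAntilipschitz (K := 1) ℂ (g := fun x => (x, η)) (by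
      have : (fun x : Rn n => (x, η)) = fun x =>
        ContinuousLinearMap.inl ℝ (Rn n) (Rn n) x + (0, η) := by ext <;> simp
      rw [this]
      exact (ContinuousLinearMap.hasTemperateGrowth _).add (.const _))
    (by intro x y; simp [Prod.edist_eq])

theorem slice_apply (η : Rn n) (f : 𝓢(Rn n × Rn n, G)) (x : Rn n) : slice η f x = f (x, η) := rfl

theorem integrable_slice (f : 𝓢(Rn n × Rn n, G)) (p : Rn n × Rn n) :
    Integrable (fun x => Complex.exp (-Complex.I * (inner ℝ x p.1 : ℝ)) • f (x, p.2)) := by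
  refine (slice p.2 f).integrable.norm.mono' ?_ ?_
  · exact (Continuous.smul (by fun_prop) (f.continuous.comp (by fun_prop))).aestronglyMeasurable
  · filter_upwards with x
    rw [norm_smul, norm_phase, one_mul, slice_apply]

theorem partialFourierFun_eq (f : 𝓢(Rn n × Rn n, G)) (p : Rn n × Rn n) :
    partialFourierFun f p = FourierTransform.fourier (slice p.2 f : Rn n → G) (scale p.1) :=
  (fourier_scale _ _).symm

/-- Precomposition of a linear map on `ℝⁿ × ℝⁿ` with `(h, k) ↦ (0, k)`. -/
def restrictSnd : (Rn n × Rn n →L[ℝ] G) →L[ℂ] (Rn n × Rn n →L[ℝ] G) :=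
  LinearMap.mkContinuous
    { toFun := fun T => T ∘L ((0 : Rn n × Rn n →L[ℝ] Rn n).prod
        (ContinuousLinearMap.snd ℝ (Rn n) (Rn n)))
      map_add' := fun _ _ => rfl
      map_smul' := fun _ _ => rfl }
    ‖((0 : Rn n × Rn n →L[ℝ] Rn n).prod (ContinuousLinearMap.snd ℝ (Rn n) (Rn n)))‖
    (fun T => by rw [mul_comm]; exact ContinuousLinearMap.opNorm_comp_le _ _)

/-- The Schwartz function whose partial Fourier transform is the derivative of that of `f`,
`(x, η) ↦ ((h, k) ↦ -i (x·h) f(x, η) + Df(x, η)(0, k))`. -/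
def derivSymbol : 𝓢(Rn n × Rn n, G) →L[ℂ] 𝓢(Rn n × Rn n, Rn n × Rn n →L[ℝ] G) :=
  (-Complex.I) • smulRightCLM ℂ G
      ((innerSL ℝ (E := Rn n)).bilinearComp (ContinuousLinearMap.fst ℝ (Rn n) (Rn n))
        (ContinuousLinearMap.fst ℝ (Rn n) (Rn n))) +
    postcompCLM restrictSnd ∘L fderivCLM ℂ (Rn n × Rn n) G

theorem derivSymbol_apply (f : 𝓢(Rn n × Rn n, G)) (q h : Rn n × Rn n) :
    derivSymbol f q h =
      -Complex.I • (inner ℝ q.1 h.1 : ℝ) • f q + fderiv ℝ f q (0, h.2) := rfl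

theorem hasFDerivAt_partialFourierFun (f : 𝓢(Rn n × Rn n, G)) (p : Rn n × Rn n) :
    HasFDerivAt (partialFourierFun f) (partialFourierFun (derivSymbol f) p) p := by
  let F : Rn n × Rn n → Rn n → G :=
    fun p x => Complex.exp (-Complex.I * (inner ℝ x p.1 : ℝ)) • f (x, p.2)
  let F' : Rn n × Rn n → Rn n → Rn n × Rn n →L[ℝ] G :=
    fun p x => Complex.exp (-Complex.I * (inner ℝ x p.1 : ℝ)) • derivSymbol f (x, p.2)
  let B : Rn n → ℝ := fun x => (1 + ‖x‖) ^ (-(n + 1 : ℝ)) * (2 ^ (0 + (n + 1)) *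
        (Finset.Iic (0 + (n + 1), 0)).sup
          (schwartzSeminormFamily ℂ (Rn n × Rn n) _) (derivSymbol f))
  have h1 : ∀ᶠ q in 𝓝 p, AEStronglyMeasurable (F q) volume :=
    .of_forall fun q => (integrable_slice f q).aestronglyMeasurable
  have h3 : AEStronglyMeasurable (F' p) volume :=
    (integrable_slice (derivSymbol f) p).aestronglyMeasurable
  have h4 : ∀ᵐ x : Rn n, ∀ q ∈ (Set.univ : Set (Rn n × Rn n)), ‖F' q x‖ ≤ B x := by
    filter_upwards with x q _
    have := norm_mul_iteratedFDeriv_le (derivSymbol f) 0 0 x q.2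
    rw [pow_zero, one_mul, norm_iteratedFDeriv_zero] at this
    simp only [F']
    rw [norm_smul, norm_phase, one_mul]
    exact this
  have h5 : Integrable B volume := integrable_weight.mul_const _
  have h6 : ∀ᵐ x : Rn n, ∀ q ∈ (Set.univ : Set (Rn n × Rn n)),
      HasFDerivAt (fun q => F q x) (F' q x) q := by
    filter_upwards with x q _
    have h1 : HasFDerivAt (fun q : Rn n × Rn n => (inner ℝ x q.1 : ℝ))
        ((innerSL ℝ x) ∘L ContinuousLinearMap.fst ℝ (Rn n) (Rn n)) q :=
      ((innerSL ℝ x) ∘L ContinuousLinearMap.fst ℝ (Rn n) (Rn n)).hasFDerivAt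
    have h2 := ((Complex.ofRealCLM.hasFDerivAt.comp q h1).const_mul (-Complex.I)).cexp
    have h3 : HasFDerivAt (fun q : Rn n × Rn n => (x, q.2))
        ((0 : Rn n × Rn n →L[ℝ] Rn n).prod (ContinuousLinearMap.snd ℝ (Rn n) (Rn n))) q :=
      (hasFDerivAt_const x q).prodMk (ContinuousLinearMap.snd ℝ (Rn n) (Rn n)).hasFDerivAt
    have h4 : HasFDerivAt (fun q : Rn n × Rn n => f (x, q.2)) _ q :=
      (f.hasFDerivAt (x, q.2)).comp q h3
    refine (h2.smul h4).congr_fderiv ?_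
    refine ContinuousLinearMap.ext fun h => ?_
    simp [F', derivSymbol_apply, smul_smul, mul_comm, mul_left_comm, add_comm]
    rw [← Complex.coe_smul (inner ℝ x h.1), smul_smul]
    congr 1
    ring
  exact hasFDerivAt_integral_of_dominated_of_fderiv_le Filter.univ_mem h1 (integrable_slice f p)
    h3 h4 h5 h6

theorem contDiff_partialFourierFun (m : ℕ) :
    ∀ {G : Type} [NormedAddCommGroup G] [NormedSpace ℂ G] (f : 𝓢(Rn n × Rn n, G)),
      ContDiff ℝ m (partialFourierFun f) := by
  induction m with
  | zero =>
    intro G _ _ f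
    exact contDiff_zero.2
      (continuous_iff_continuousAt.2 fun p => (hasFDerivAt_partialFourierFun f p).continuousAt)
  | succ m ih =>
    intro G _ _ f
    have h : fderiv ℝ (partialFourierFun f) = partialFourierFun (derivSymbol f) :=
      funext fun p => (hasFDerivAt_partialFourierFun f p).fderiv
    push_cast
    rw [contDiff_succ_iff_fderiv]
    refine ⟨fun p => (hasFDerivAt_partialFourierFun f p).differentiableAt, by simp, ?_⟩
    rw [h]
    exact ih _

theorem norm_pow_mul_partialFourierFun_le (k : ℕ) : ∃ (s : Finset (ℕ × ℕ)) (C : ℝ), 0 ≤ C ∧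
    ∀ {G : Type} [NormedAddCommGroup G] [NormedSpace ℂ G] (f : 𝓢(Rn n × Rn n, G))
      (p : Rn n × Rn n), ‖p‖ ^ k * ‖partialFourierFun f p‖ ≤
        C * s.sup (schwartzSeminormFamily ℂ (Rn n × Rn n) G) f := by
  set I : ℝ := ∫ x : Rn n, (1 + ‖x‖) ^ (-(n + 1 : ℝ)) with hI
  have hI0 : 0 ≤ I := integral_nonneg fun x => by positivity
  refine ⟨Finset.Iic (k + (n + 1), k),
    I * 2 ^ (k + (n + 1)) + (2 * Real.pi) ^ k * (2 ^ k * ((k + 1) * (I * 2 ^ (k + (n + 1))))),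
    by positivity, ?_⟩
  intro G _ _ f p
  set S := (Finset.Iic (k + (n + 1), k)).sup (schwartzSeminormFamily ℂ (Rn n × Rn n) G) f with hS
  have hS0 : 0 ≤ S := apply_nonneg _ _
  have mono : ∀ i j, i ≤ k → j ≤ k → 2 ^ (i + (n + 1)) *
      (Finset.Iic (i + (n + 1), j)).sup (schwartzSeminormFamily ℂ (Rn n × Rn n) G) f ≤
        2 ^ (k + (n + 1)) * S := by
    intro i j hi hj
    have hsub : Finset.Iic (i + (n + 1), j) ⊆ Finset.Iic (k + (n + 1), k) :=
      Finset.Iic_subset_Iic.2 ⟨by simpa using hi, hj⟩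
    have := Seminorm.le_def.1
      (Finset.sup_mono (f := schwartzSeminormFamily ℂ (Rn n × Rn n) G) hsub) f
    gcongr
    norm_num
  have hint : ∀ i j, i ≤ k → j ≤ k → ∀ η : Rn n,
      ∫ x, ‖η‖ ^ i * ‖iteratedFDeriv ℝ j f (x, η)‖ ≤ I * (2 ^ (k + (n + 1)) * S) := by
    intro i j hi hj η
    rw [hI, ← integral_mul_const]
    refine integral_mono ((integrable_slice_deriv f j η).const_mul _)
      (integrable_weight.mul_const _) fun x => ?_
    refine (norm_mul_iteratedFDeriv_le f i j x η).trans ?_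
    gcongr ?_ * ?_
    exact mono i j hi hj
  have hA : ‖p.2‖ ^ k * ‖partialFourierFun f p‖ ≤ I * (2 ^ (k + (n + 1)) * S) := by
    refine le_trans ?_ (hint k 0 le_rfl (Nat.zero_le _) p.2)
    rw [integral_const_mul]
    gcongr
    refine (norm_integral_le_integral_norm _).trans (le_of_eq ?_)
    congr 1 with x
    rw [norm_smul, norm_phase, one_mul, norm_iteratedFDeriv_zero]
  have hB : ‖p.1‖ ^ k * ‖partialFourierFun f p‖ ≤
      (2 * Real.pi) ^ k * (2 ^ k * ((k + 1) * (I * (2 ^ (k + (n + 1)) * S)))) := by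
    have h := Real.pow_mul_norm_iteratedFDeriv_fourier_le ((slice p.2 f).smooth ⊤)
      (K := ⊤) (fun a b _ _ => integrable_pow_mul_iteratedFDeriv volume (slice p.2 f) a b)
      (k := 0) (n := k) le_top le_top (scale p.1)
    rw [norm_iteratedFDeriv_zero, ← partialFourierFun_eq, scale_apply, norm_smul, mul_pow,
      Real.norm_of_nonneg (by positivity), inv_pow, mul_assoc, inv_mul_le_iff₀ (by positivity)] at h
    refine h.trans ?_
    have : ∑ q ∈ Finset.range (0 + 1) ×ˢ Finset.range (k + 1),
        ∫ v, ‖v‖ ^ q.1 * ‖iteratedFDeriv ℝ q.2 (slice p.2 f) v‖ ≤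
        (k + 1) * (I * (2 ^ (k + (n + 1)) * S)) := by
      refine (Finset.sum_le_card_nsmul _ _ (I * (2 ^ (k + (n + 1)) * S)) ?_).trans ?_
      · rintro ⟨a, j⟩ hq
        simp only [zero_add, Finset.mem_product, Finset.mem_range, Nat.lt_one_iff] at hq
        obtain ⟨rfl, hj⟩ := hq
        refine le_trans ?_ (hint 0 j (Nat.zero_le _) (by omega) p.2)
        refine integral_mono (integrable_pow_mul_iteratedFDeriv volume (slice p.2 f) 0 j)
          ((integrable_slice_deriv f j p.2).const_mul _) fun x => ?_
        simp only [pow_zero, one_mul]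
        exact norm_iteratedFDeriv_slice_le f j x p.2
      · simp
    simp only [pow_zero, one_mul, Nat.cast_zero, mul_zero, zero_add] at this ⊢
    gcongr
  calc ‖p‖ ^ k * ‖partialFourierFun f p‖
      ≤ ‖p.2‖ ^ k * ‖partialFourierFun f p‖ + ‖p.1‖ ^ k * ‖partialFourierFun f p‖ := by
        rw [← add_mul]
        gcongr
        rw [Prod.norm_def]
        rcases max_choice ‖p.1‖ ‖p.2‖ with h | h <;> rw [h]
        · exact le_add_of_nonneg_left (by positivity)
        · exact le_add_of_nonneg_right (by positivity)
    _ ≤ _ := add_le_add hA hB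
    _ = _ := by ring

theorem norm_pow_mul_iteratedFDeriv_partialFourierFun_le (k m : ℕ) :
    ∀ {G : Type} [NormedAddCommGroup G] [NormedSpace ℂ G],
      ∃ (s : Finset (ℕ × ℕ)) (C : ℝ), 0 ≤ C ∧ ∀ (f : 𝓢(Rn n × Rn n, G)) (p : Rn n × Rn n),
        ‖p‖ ^ k * ‖iteratedFDeriv ℝ m (partialFourierFun f) p‖ ≤
          C * s.sup (schwartzSeminormFamily ℂ (Rn n × Rn n) G) f := by
  induction m with
  | zero =>
    intro G _ _
    obtain ⟨s, C, hC, h⟩ := norm_pow_mul_partialFourierFun_le (n := n) k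
    exact ⟨s, C, hC, fun f p => by rw [norm_iteratedFDeriv_zero]; exact h f p⟩
  | succ m ih =>
    intro G _ _
    obtain ⟨s, C, hC, h⟩ := ih (G := Rn n × Rn n →L[ℝ] G)
    let q : Seminorm ℂ 𝓢(Rn n × Rn n, G) :=
      (s.sup (schwartzSeminormFamily ℂ (Rn n × Rn n) (Rn n × Rn n →L[ℝ] G))).comp
        (derivSymbol (n := n) (G := G)).toLinearMap
    have hq : Continuous q := by
      have := Seminorm.continuous_finsetSup (s := s)
        (p := schwartzSeminormFamily ℂ (Rn n × Rn n) (Rn n × Rn n →L[ℝ] G))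
        (fun i _ => (schwartz_withSeminorms ℂ (Rn n × Rn n) _).continuous_seminorm i)
      exact this.comp (derivSymbol (n := n) (G := G)).continuous
    obtain ⟨t, D, _, hD⟩ := Seminorm.bound_of_continuous
      (schwartz_withSeminorms ℂ (Rn n × Rn n) G) q hq
    refine ⟨t, C * D, by positivity, fun f p => ?_⟩
    have hf : fderiv ℝ (partialFourierFun f) = partialFourierFun (derivSymbol f) :=
      funext fun p => (hasFDerivAt_partialFourierFun f p).fderiv
    rw [← norm_iteratedFDeriv_fderiv, hf, mul_assoc]
    refine (h (derivSymbol f) p).trans ?_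
    gcongr
    exact hD f

end Partial

/-- The partial Fourier transformation in the first variable on Schwartz functions,
`(ξ, η) ↦ ∫ e^{-i x·ξ} f(x, η) dx`. -/
def partialFourierS : 𝓢(Rn n × Rn n, ℂ) →L[ℂ] 𝓢(Rn n × Rn n, ℂ) :=
  SchwartzMap.mkCLM (fun f => partialFourierFun f)
    (fun f g p => by
      simp only [partialFourierFun, add_apply, smul_add]
      exact integral_add (integrable_slice f p) (integrable_slice g p))
    (fun a f p => by
      simp only [partialFourierFun, smul_apply, smul_comm _ a, RingHom.id_apply]
      exact integral_smul _ _)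
    (fun f => contDiff_infty.2 fun m => contDiff_partialFourierFun m f)
    (fun q => norm_pow_mul_iteratedFDeriv_partialFourierFun_le q.1 q.2)

theorem partialFourierS_apply (f : 𝓢(Rn n × Rn n, ℂ)) (p : Rn n × Rn n) :
    partialFourierS f p = ∫ x, Complex.exp (-Complex.I * (inner ℝ x p.1 : ℝ)) * f (x, p.2) := rfl

/-- The partial Fourier transformation in the first variable on tempered distributions. -/
def partialFourierD : 𝓢'(Rn n × Rn n, ℂ) →L[ℂ] 𝓢'(Rn n × Rn n, ℂ) :=
  PointwiseConvergenceCLM.precomp ℂ partialFourierS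

/-- `b̂ = F_{x → ξ} b`, a tempered distribution on `ℝⁿ × ℝⁿ`. -/
def symbolHat (b : Rn n × Rn n → ℂ) (hb : IsSymbol b) : 𝓢'(Rn n × Rn n, ℂ) :=
  partialFourierD (hb.hasTemperateGrowth.toTemperedDistribution volume)

/-! ### Pseudo-differential operators -/

/-- `OP(b)u(x) = (2π)⁻ⁿ ∫ e^{i x·ξ} b(x,ξ) û(ξ) dξ` for a Schwartz function `u`. -/
def opS (b : Rn n × Rn n → ℂ) (u : 𝓢(Rn n, ℂ)) (x : Rn n) : ℂ :=
  ((2 * Real.pi : ℂ) ^ n)⁻¹ *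
    ∫ ξ, Complex.exp (Complex.I * (inner ℝ x ξ : ℝ)) * (b (x, ξ) * fourierS u ξ)

theorem norm_iteratedFDeriv_comp_fst_le (φ : 𝓢(Rn n, ℂ)) (i : ℕ) (p : Rn n × Rn n) :
    ‖iteratedFDeriv ℝ i (fun q : Rn n × Rn n => φ q.1) p‖ ≤ ‖iteratedFDeriv ℝ i φ p.1‖ := by
  change ‖iteratedFDeriv ℝ i (φ ∘ (ContinuousLinearMap.fst ℝ (Rn n) (Rn n))) p‖ ≤ _
  rw [ContinuousLinearMap.iteratedFDeriv_comp_right _ (φ.smooth ⊤) _ (i := i) (mod_cast le_top)]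
  refine (ContinuousMultilinearMap.norm_compContinuousLinearMap_le _ _).trans ?_
  refine mul_le_of_le_one_right (norm_nonneg _) ?_
  exact Finset.prod_le_one (fun _ _ => norm_nonneg _)
    fun _ _ => ContinuousLinearMap.norm_fst_le ℝ (Rn n) (Rn n)

theorem norm_iteratedFDeriv_comp_snd_le (φ : 𝓢(Rn n, ℂ)) (i : ℕ) (p : Rn n × Rn n) :
    ‖iteratedFDeriv ℝ i (fun q : Rn n × Rn n => φ q.2) p‖ ≤ ‖iteratedFDeriv ℝ i φ p.2‖ := by
  change ‖iteratedFDeriv ℝ i (φ ∘ (ContinuousLinearMap.snd ℝ (Rn n) (Rn n))) p‖ ≤ _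
  rw [ContinuousLinearMap.iteratedFDeriv_comp_right _ (φ.smooth ⊤) _ (i := i) (mod_cast le_top)]
  refine (ContinuousMultilinearMap.norm_compContinuousLinearMap_le _ _).trans ?_
  refine mul_le_of_le_one_right (norm_nonneg _) ?_
  exact Finset.prod_le_one (fun _ _ => norm_nonneg _)
    fun _ _ => ContinuousLinearMap.norm_snd_le ℝ (Rn n) (Rn n)

/-- `φ ↦ φ ⊗ χ`, where `(φ ⊗ χ)(x, ξ) = φ(x) χ(ξ)`. -/
def tensorS (χ : 𝓢(Rn n, ℂ)) : 𝓢(Rn n, ℂ) →L[ℂ] 𝓢(Rn n × Rn n, ℂ) :=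
  SchwartzMap.mkCLM (fun φ p => φ p.1 * χ p.2)
    (fun f g p => by simp [add_mul])
    (fun a f p => by simp [mul_assoc])
    (fun f => ((f.smooth ⊤).comp contDiff_fst).mul ((χ.smooth ⊤).comp contDiff_snd)) <| by
  rintro ⟨k, m⟩
  choose B hB using fun j => χ.decay k j
  choose B' hB' using fun j => χ.decay 0 j
  refine ⟨Finset.Iic (k, m), ∑ i ∈ Finset.range (m + 1),
    (m.choose i : ℝ) * (B' (m - i) + B (m - i)), ?_, ?_⟩
  · exact Finset.sum_nonneg fun i _ => by
      have := (hB (m - i)).1.le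
      have := (hB' (m - i)).1.le
      positivity
  intro φ p
  set S := (Finset.Iic (k, m)).sup (schwartzSeminormFamily ℂ (Rn n) ℂ) φ with hS
  have hS0 : 0 ≤ S := apply_nonneg _ _
  have hle : ∀ l i, l ≤ k → i ≤ m → ‖p.1‖ ^ l * ‖iteratedFDeriv ℝ i φ p.1‖ ≤ S := by
    intro l i hl hi
    refine (φ.le_seminorm ℂ l i p.1).trans ?_
    exact Seminorm.le_def.1 (Finset.le_sup (f := schwartzSeminormFamily ℂ (Rn n) ℂ)
      (Finset.mem_Iic.2 (show (l, i) ≤ (k, m) from ⟨hl, hi⟩))) φ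
  have hmul := norm_iteratedFDeriv_mul_le (𝕜 := ℝ) (N := ∞)
    ((φ.smooth ⊤).comp (contDiff_fst (𝕜 := ℝ) (E := Rn n) (F := Rn n)))
    ((χ.smooth ⊤).comp (contDiff_snd (𝕜 := ℝ) (E := Rn n) (F := Rn n))) p (n := m) (mod_cast le_top)
  refine (mul_le_mul_of_nonneg_left hmul (by positivity)).trans ?_
  rw [Finset.mul_sum, Finset.sum_mul]
  refine Finset.sum_le_sum fun i hi => ?_
  have hi' : i ≤ m := by simpa [Nat.lt_succ_iff] using hi
  have e1 := norm_iteratedFDeriv_comp_fst_le φ i p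
  have e2 := norm_iteratedFDeriv_comp_snd_le χ (m - i) p
  have hp : ‖p‖ ^ k ≤ ‖p.1‖ ^ k + ‖p.2‖ ^ k := by
    rw [Prod.norm_def]
    rcases max_choice ‖p.1‖ ‖p.2‖ with h | h <;> rw [h]
    · exact le_add_of_nonneg_right (by positivity)
    · exact le_add_of_nonneg_left (by positivity)
  have b1 := (hB (m - i)).2 p.2
  have b2 := (hB' (m - i)).2 p.2
  have s1 := hle k i le_rfl hi'
  have s2 := hle 0 i (Nat.zero_le _) hi'
  rw [pow_zero, one_mul] at b2 s2
  calc ‖p‖ ^ k * ((m.choose i : ℝ) * ‖iteratedFDeriv ℝ i (⇑φ ∘ Prod.fst) p‖ *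
        ‖iteratedFDeriv ℝ (m - i) (⇑χ ∘ Prod.snd) p‖)
      ≤ (‖p.1‖ ^ k + ‖p.2‖ ^ k) * ((m.choose i : ℝ) * ‖iteratedFDeriv ℝ i φ p.1‖ *
        ‖iteratedFDeriv ℝ (m - i) χ p.2‖) := by
        gcongr
        · exact e1
        · exact e2
    _ = (m.choose i : ℝ) * ((‖p.1‖ ^ k * ‖iteratedFDeriv ℝ i φ p.1‖) *
          ‖iteratedFDeriv ℝ (m - i) χ p.2‖ + ‖iteratedFDeriv ℝ i φ p.1‖ *
          (‖p.2‖ ^ k * ‖iteratedFDeriv ℝ (m - i) χ p.2‖)) := by ring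
    _ ≤ (m.choose i : ℝ) * (S * B' (m - i) + S * B (m - i)) := by gcongr
    _ = _ := by ring

theorem tensorS_apply (χ φ : 𝓢(Rn n, ℂ)) (p : Rn n × Rn n) :
    tensorS χ φ p = φ p.1 * χ p.2 := rfl

/-- Restriction of a function on `ℝⁿ × ℝⁿ` to the twisted diagonal, `ξ ↦ f(-ξ, ξ)`. -/
def twistedDiagonal : 𝓢(Rn n × Rn n, ℂ) →L[ℂ] 𝓢(Rn n, ℂ) :=
  compCLMOfAntilipschitz (K := 1) ℂ (g := fun ξ : Rn n => (-ξ, ξ))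
    (((-ContinuousLinearMap.id ℝ (Rn n)).prod
      (ContinuousLinearMap.id ℝ (Rn n))).hasTemperateGrowth)
    (by intro x y; simp [Prod.edist_eq])

/-- For `b` of temperate growth and a Schwartz function `χ`, the map that takes `φ` to
`ξ ↦ (2π)⁻ⁿ ∫ e^{i x·ξ} b(x,ξ) χ(ξ) φ(x) dx`. -/
def preTranspose (b : Rn n × Rn n → ℂ) (χ : 𝓢(Rn n, ℂ)) : 𝓢(Rn n, ℂ) →L[ℂ] 𝓢(Rn n, ℂ) :=
  ((2 * Real.pi : ℂ) ^ n)⁻¹ •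
    (twistedDiagonal ∘L partialFourierS ∘L SchwartzMap.smulLeftCLM ℂ b ∘L tensorS χ)

theorem preTranspose_apply {b : Rn n × Rn n → ℂ} (hb : IsSymbol b) (χ φ : 𝓢(Rn n, ℂ))
    (ξ : Rn n) : preTranspose b χ φ ξ = ((2 * Real.pi : ℂ) ^ n)⁻¹ *
      ∫ x, Complex.exp (Complex.I * (inner ℝ x ξ : ℝ)) * (b (x, ξ) * χ ξ * φ x) := by
  change _ * partialFourierS (SchwartzMap.smulLeftCLM ℂ b (tensorS χ φ)) (-ξ, ξ) = _
  rw [partialFourierS_apply]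
  congr 2 with x
  simp only [smulLeftCLM_apply_apply hb.hasTemperateGrowth,
    tensorS_apply, inner_neg_right, smul_eq_mul]
  push_cast
  rw [neg_mul_neg]
  ring

/-- The continuous extension to tempered distributions of the operator with symbol
`b(x,ξ) χ(ξ)`, for `b ∈ S^∞_{1,1}` and `χ ∈ C_0^∞`: it is the dual of the transposed operator
`φ ↦ F (preTranspose b χ φ)` on Schwartz functions. -/
def cutoffOp (b : Rn n × Rn n → ℂ) (χ : 𝓢(Rn n, ℂ)) : 𝓢'(Rn n, ℂ) →L[ℂ] 𝓢'(Rn n, ℂ) :=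
  PointwiseConvergenceCLM.precomp ℂ (fourierS ∘L preTranspose b χ)

theorem integral_fourierS_mul (f g : 𝓢(Rn n, ℂ)) :
    ∫ x, fourierS f x * g x = ∫ x, f x * fourierS g x := by
  have h := VectorFourier.integral_fourierIntegral_smul_eq_flip (μ := (volume : Measure (Rn n)))
    (ν := (volume : Measure (Rn n))) (L := (2 * Real.pi)⁻¹ • innerₗ (Rn n))
    (f := f) (g := g) Real.continuous_fourierChar (by simp; fun_prop) f.integrable g.integrable
  have key : ∀ (u : 𝓢(Rn n, ℂ)) (x : Rn n), fourierS u x =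
      VectorFourier.fourierIntegral Real.fourierChar volume ((2 * Real.pi)⁻¹ • innerₗ (Rn n)) u x := by
    intro u x
    change FourierTransform.fourier (u : Rn n → ℂ) (scale x) = _
    rw [Real.fourier_eq, VectorFourier.fourierIntegral]
    simp [scale_apply, inner_smul_right]
  have hflip : ((2 * Real.pi)⁻¹ • innerₗ (Rn n)).flip = (2 * Real.pi)⁻¹ • innerₗ (Rn n) := by
    ext x y; simp [real_inner_comm]
  rw [hflip] at h
  simp_rw [key]
  exact h

/-- On Schwartz functions `cutoffOp b χ` is the operator with symbol `b(x,ξ) χ(ξ)`. -/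
theorem cutoffOp_schwartz {b : Rn n × Rn n → ℂ} (hb : IsSymbol b) (χ u φ : 𝓢(Rn n, ℂ)) :
    cutoffOp b χ (u : 𝓢'(Rn n, ℂ)) φ = ∫ x, φ x * opS (fun p => b p * χ p.2) u x := by
  change toTemperedDistributionCLM (Rn n) ℂ volume u (fourierS (preTranspose b χ φ)) = _
  refine (toTemperedDistributionCLM_apply_apply volume u _).trans ?_
  simp only [smul_eq_mul]
  rw [integral_fourierS_mul]
  simp_rw [preTranspose_apply hb, opS]
  have hH : Integrable (fun p : Rn n × Rn n => Complex.exp (Complex.I * (inner ℝ p.1 p.2 : ℝ)) *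
      (b p * (φ p.1 * (χ p.2 * fourierS u p.2)))) (volume.prod volume) := by
    have hs := (SchwartzMap.smulLeftCLM ℂ b (tensorS (SchwartzMap.smulLeftCLM ℂ χ (fourierS u)) φ)).integrable
      (μ := volume)
    refine hs.norm.mono' ?_ ?_
    · have := hb.hasTemperateGrowth.1.continuous
      have := χ.continuous
      have := φ.continuous
      have := (fourierS u).continuous
      exact Continuous.aestronglyMeasurable (by fun_prop)
    · filter_upwards with p
      rw [norm_mul, Complex.norm_exp]
      simp [smulLeftCLM_apply_apply hb.hasTemperateGrowth, tensorS_apply,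
        smulLeftCLM_apply_apply χ.hasTemperateGrowth]
  have hsw := integral_integral_swap (f := fun x ξ => Complex.exp (Complex.I * (inner ℝ x ξ : ℝ)) *
      (b (x, ξ) * (φ x * (χ ξ * fourierS u ξ)))) hH
  calc _ = ((2 * Real.pi : ℂ) ^ n)⁻¹ * ∫ ξ, ∫ x, Complex.exp (Complex.I * (inner ℝ x ξ : ℝ)) *
      (b (x, ξ) * (φ x * (χ ξ * fourierS u ξ))) := by
        rw [← integral_const_mul]
        congr 1 with ξ
        rw [mul_assoc, ← integral_mul_const]
        congr 2 with x
        ring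
    _ = _ := by
        rw [← hsw, ← integral_const_mul]
        congr 1 with x
        rw [mul_left_comm, ← integral_const_mul (φ x)]
        congr 2 with ξ
        ring

/-- `χ` is a smooth function with compact support that equals `1` in a neighbourhood of `K`. -/
structure IsCutoff (K : Set (Rn n)) (χ : 𝓢(Rn n, ℂ)) : Prop where
  hasCompactSupport : HasCompactSupport χ
  eq_one : ∀ᶠ η in 𝓝ˢ K, χ η = 1

theorem exists_isCutoff {K : Set (Rn n)} (hK : IsCompact K) : ∃ χ, IsCutoff K χ := by
  obtain ⟨L, hL, hKL⟩ := exists_compact_superset hK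
  obtain ⟨f, hf1, hf0, -⟩ := exists_contMDiffMap_one_nhds_of_subset_interior
    (modelWithCornersSelf ℝ (Rn n)) (n := ⊤) hK.isClosed hKL
  have hs : HasCompactSupport (fun x => (f x : ℂ)) :=
    HasCompactSupport.intro hL fun x hx => by simp [hf0 x hx]
  have hd : ContDiff ℝ ∞ (fun x => (f x : ℂ)) :=
    Complex.ofRealCLM.contDiff.comp f.contMDiff.contDiff
  refine ⟨hs.toSchwartzMap hd, hs, ?_⟩
  filter_upwards [hf1] with x hx
  change (f x : ℂ) = 1
  simp [hx]

/-- A tempered distribution vanishes on test functions with compact support that does not meet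
its support. -/
theorem apply_eq_zero_of_disjoint (w : 𝓢'(Rn n, ℂ)) (ψ : 𝓢(Rn n, ℂ)) (hc : HasCompactSupport ψ)
    (hd : Disjoint (tsupport ψ) (dsupport w)) : w ψ = 0 := by
  have hx : ∀ x : tsupport ψ, ∃ s : Set (Rn n), IsVanishingOn w s ∧ IsOpen s ∧ (x : Rn n) ∈ s :=
    fun x => (notMem_dsupport_iff (f := w) _).1 (Set.disjoint_left.1 hd x.2)
  choose U hU hUo hxU using hx
  obtain ⟨t, ht⟩ := hc.elim_finite_subcover U hUo fun x hx => Set.mem_iUnion.2 ⟨⟨x, hx⟩, hxU _⟩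
  obtain ⟨ρ, hρ⟩ := SmoothPartitionOfUnity.exists_isSubordinate (modelWithCornersSelf ℝ (Rn n))
    (isClosed_tsupport ψ) (fun i : t => U i) (fun i => hUo i) (by
      intro x hx
      obtain ⟨i, hi, hxi⟩ := Set.mem_iUnion₂.1 (ht hx)
      exact Set.mem_iUnion.2 ⟨⟨i, hi⟩, hxi⟩)
  have hcs : ∀ i : t, HasCompactSupport (fun x => (ρ i x : ℂ) * ψ x) := fun i => hc.mul_left
  have hcd : ∀ i : t, ContDiff ℝ ∞ (fun x => (ρ i x : ℂ) * ψ x) := fun i =>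
    (Complex.ofRealCLM.contDiff.comp (ρ i).contMDiff.contDiff).mul (ψ.smooth ⊤)
  have hsum : ψ = ∑ i : t, (hcs i).toSchwartzMap (hcd i) := by
    ext x
    rw [sum_apply]
    change ψ x = ∑ i : t, (ρ i x : ℂ) * ψ x
    rw [← Finset.sum_mul]
    by_cases h : x ∈ tsupport ψ
    · have h1 := ρ.sum_eq_one h
      rw [finsum_eq_sum_of_fintype] at h1
      rw [← Complex.ofReal_sum, h1]
      simp
    · rw [image_eq_zero_of_notMem_tsupport h, mul_zero]
  rw [hsum, map_sum]
  refine Finset.sum_eq_zero fun i _ => hU i _ ?_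
  refine subset_trans ?_ (hρ i)
  refine closure_mono fun x hx => ?_
  simp only [Function.mem_support] at hx ⊢
  intro h0
  apply hx
  change (ρ i x : ℂ) * ψ x = 0
  simp [h0]

/-- `cutoffOp b χ v` does not depend on the cutoff function `χ`. -/
theorem cutoffOp_eq {b : Rn n × Rn n → ℂ} (hb : IsSymbol b) {v : 𝓢'(Rn n, ℂ)}
    {χ χ' : 𝓢(Rn n, ℂ)} (hχ : IsCutoff (dsupport (fourierD v)) χ)
    (hχ' : IsCutoff (dsupport (fourierD v)) χ') : cutoffOp b χ v = cutoffOp b χ' v := by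
  ext φ
  rw [← sub_eq_zero]
  change fourierD v (preTranspose b χ φ) - fourierD v (preTranspose b χ' φ) = 0
  rw [← map_sub]
  have hz : ∀ ξ, χ ξ = χ' ξ → (preTranspose b χ φ - preTranspose b χ' φ) ξ = 0 := by
    intro ξ h
    rw [sub_apply, preTranspose_apply hb, preTranspose_apply hb, h, sub_self]
  apply apply_eq_zero_of_disjoint
  · refine HasCompactSupport.intro (hχ.hasCompactSupport.isCompact.union
      hχ'.hasCompactSupport.isCompact) fun ξ h => hz ξ ?_
    rw [Set.mem_union, not_or] at h
    rw [image_eq_zero_of_notMem_tsupport h.1, image_eq_zero_of_notMem_tsupport h.2]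
  · rw [Set.disjoint_right]
    intro ξ hξ
    rw [notMem_tsupport_iff_eventuallyEq]
    have h1 := (eventually_nhdsSet_iff_forall.1 hχ.eq_one) ξ hξ
    have h2 := (eventually_nhdsSet_iff_forall.1 hχ'.eq_one) ξ hξ
    filter_upwards [h1, h2] with η e1 e2
    exact hz η (e1.trans e2.symm)

/-- `b(x,D)v` for `b ∈ S^∞_{1,1}` and a tempered distribution `v` whose Fourier transform has
compact support: the operator with symbol `b(x,ξ) χ(ξ)` applied to `v`, for any
`χ ∈ C_0^∞` that equals `1` in a neighbourhood of `supp v̂`; see `psiDO_eq` for the independence of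
the choice of `χ`, and `psiDO_schwartz` for the case of Schwartz functions `v`. -/
def psiDO (b : Rn n × Rn n → ℂ) (v : 𝓢'(Rn n, ℂ)) (hv : IsCompact (dsupport (fourierD v))) :
    𝓢'(Rn n, ℂ) :=
  cutoffOp b (exists_isCutoff hv).choose v

theorem psiDO_eq {b : Rn n × Rn n → ℂ} (hb : IsSymbol b) {v : 𝓢'(Rn n, ℂ)}
    (hv : IsCompact (dsupport (fourierD v))) {χ : 𝓢(Rn n, ℂ)}
    (hχ : IsCutoff (dsupport (fourierD v)) χ) : psiDO b v hv = cutoffOp b χ v :=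
  cutoffOp_eq hb (exists_isCutoff hv).choose_spec hχ

theorem fourierS_eq_zero_of_notMem_dsupport (u : 𝓢(Rn n, ℂ)) {ξ : Rn n}
    (hξ : ξ ∉ dsupport (fourierD (u : 𝓢'(Rn n, ℂ)))) : fourierS u ξ = 0 := by
  obtain ⟨s, hs, hso, hξs⟩ := (notMem_dsupport_iff _).1 hξ
  have hae := hso.ae_eq_zero_of_integral_contDiff_smul_eq_zero (μ := volume)
    (f := fun η => fourierS u η) ((fourierS u).integrable.locallyIntegrable.locallyIntegrableOn s)
    (fun g hg hgc hgs => by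
      have hd : ContDiff ℝ ∞ (fun x => (g x : ℂ)) := Complex.ofRealCLM.contDiff.comp hg
      have hc : HasCompactSupport (fun x => (g x : ℂ)) :=
        hgc.comp_left (g := Complex.ofReal) Complex.ofReal_zero
      have h := hs (hc.toSchwartzMap hd) (by
        refine subset_trans (closure_mono fun x hx => ?_) hgs
        intro h0
        exact hx (by change (g x : ℂ) = 0; simp [h0]))
      have h' : ∫ x, fourierS (hc.toSchwartzMap hd) x * u x = 0 :=
        (toTemperedDistributionCLM_apply_apply volume u _).symm.trans h
      rw [integral_fourierS_mul] at h'
      exact h')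
  by_contra hne
  have hopen : IsOpen (s ∩ {η | fourierS u η ≠ 0}) :=
    hso.inter (isOpen_ne_fun (fourierS u).continuous continuous_const)
  have hpos := hopen.measure_pos volume ⟨ξ, hξs, hne⟩
  refine hpos.ne' (measure_mono_null (fun η hη => ?_) hae)
  simp only [Set.mem_compl_iff, Set.mem_ofPred_eq]
  exact fun h => hη.2 (h hη.1)

/-- If `u` is a Schwartz function and `û` has compact support, then `b(x,D)u = OP(b)u`. -/
theorem psiDO_schwartz {b : Rn n × Rn n → ℂ} (hb : IsSymbol b) (u : 𝓢(Rn n, ℂ))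
    (hu : IsCompact (dsupport (fourierD (u : 𝓢'(Rn n, ℂ))))) (φ : 𝓢(Rn n, ℂ)) :
    psiDO b (u : 𝓢'(Rn n, ℂ)) hu φ = ∫ x, φ x * opS b u x := by
  obtain ⟨χ, hχ⟩ := exists_isCutoff hu
  rw [psiDO_eq hb hu hχ, cutoffOp_schwartz hb]
  have h : opS (fun p => b p * χ p.2) u = opS b u := by
    ext x
    simp only [opS]
    congr 2 with ξ
    by_cases hξ : ξ ∈ dsupport (fourierD (u : 𝓢'(Rn n, ℂ)))
    · rw [(eventually_nhdsSet_iff_forall.1 hχ.eq_one ξ hξ).self_of_nhds, mul_one]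
    · simp [fourierS_eq_zero_of_notMem_dsupport u hξ]
  rw [h]

end TypeOneOne

end

noncomputable section

namespace TypeOneOne

variable {n : ℕ}

/-! Everything is moved onto test functions. By duality `⟨F(b(x,D)v), φ⟩ = ⟨v̂, w⟩` with `w =
preTranspose b χ φ̂`, that is `w(η) = (2π)⁻ⁿ χ(η) ∫ e^{i x·η} b(x,η) φ̂(x) dx`. Inserting the
integral for `φ̂` gives, formally, `w(η) = (2π)⁻ⁿ χ(η) ∫ b̂(ζ - η, η) φ(ζ) dζ`. Hence `w` vanishes
at `η` as soon as the points `(ζ - η, η)`, with `ζ ∈ supp φ`, stay away from `supp b̂`.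

If `ζ₀` is not of the form `ξ + η` with `(ξ, η) ∈ supp b̂` and `η ∈ supp v̂`, then `(ζ₀ - η, η) ∉
supp b̂` for all `η ∈ supp v̂`. Since `supp b̂` is closed and `supp v̂` compact, this persists for
`ζ` in a neighbourhood `U` of `ζ₀` and `η` in a neighbourhood `V` of `supp v̂`
(`exists_nhds_forall_sub_notMem`). For `φ` supported in `U`, the function `w` is then zero on `V`,
so `⟨v̂, w⟩ = 0`.

As `b̂` is only a distribution, the formula for `w` is read weakly: `integral_preTranspose_mul`
pairs `w` with `ψ` and obtains `b̂` applied to `φ(ξ + η) χ(η) ψ(η)`. The vanishing of all these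
pairings makes the continuous function `w` zero pointwise on `V` (`preTranspose_fourierS_eq_zero`).
-/

/-! ### Distributions and continuous functions tested against compactly supported functions. -/

/-- A tempered distribution on a finite-dimensional space vanishes on test functions with compact
support that does not meet its support. -/
theorem apply_eq_zero_of_disjoint_dsupport {E : Type*} [NormedAddCommGroup E] [NormedSpace ℝ E]
    [FiniteDimensional ℝ E] (w : 𝓢'(E, ℂ)) (ψ : 𝓢(E, ℂ)) (hc : HasCompactSupport ψ)
    (hd : Disjoint (tsupport ψ) (dsupport w)) : w ψ = 0 := by
  have hx : ∀ x : tsupport ψ, ∃ s : Set E, IsVanishingOn w s ∧ IsOpen s ∧ (x : E) ∈ s :=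
    fun x => (notMem_dsupport_iff (f := w) _).1 (Set.disjoint_left.1 hd x.2)
  choose U hU hUo hxU using hx
  -- Compactness makes the partition of unity finite, so `ψ` is a finite sum of test functions, each
  -- supported in one set where `w` vanishes, and linearity suffices.
  obtain ⟨t, ht⟩ := hc.elim_finite_subcover U hUo fun x hx => Set.mem_iUnion.2 ⟨⟨x, hx⟩, hxU _⟩
  obtain ⟨ρ, hρ⟩ := SmoothPartitionOfUnity.exists_isSubordinate (modelWithCornersSelf ℝ E)
    (isClosed_tsupport ψ) (fun i : t => U i) (fun i => hUo i) (by
      intro x hx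
      obtain ⟨i, hi, hxi⟩ := Set.mem_iUnion₂.1 (ht hx)
      exact Set.mem_iUnion.2 ⟨⟨i, hi⟩, hxi⟩)
  have hcs : ∀ i : t, HasCompactSupport (fun x => (ρ i x : ℂ) * ψ x) := fun i => hc.mul_left
  have hcd : ∀ i : t, ContDiff ℝ ∞ (fun x => (ρ i x : ℂ) * ψ x) := fun i =>
    (Complex.ofRealCLM.contDiff.comp (ρ i).contMDiff.contDiff).mul (ψ.smooth ⊤)
  have hsum : ψ = ∑ i : t, (hcs i).toSchwartzMap (hcd i) := by
    ext x
    rw [sum_apply]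
    change ψ x = ∑ i : t, (ρ i x : ℂ) * ψ x
    rw [← Finset.sum_mul]
    by_cases h : x ∈ tsupport ψ
    · have h1 := ρ.sum_eq_one h
      rw [finsum_eq_sum_of_fintype] at h1
      rw [← Complex.ofReal_sum, h1]
      simp
    · rw [image_eq_zero_of_notMem_tsupport h, mul_zero]
  rw [hsum, map_sum]
  refine Finset.sum_eq_zero fun i _ => hU i _ ?_
  refine subset_trans (closure_mono fun x hx => ?_) (hρ i)
  simp only [Function.mem_support] at hx ⊢
  intro h0
  apply hx
  change (ρ i x : ℂ) * ψ x = 0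
  simp [h0]

/-- A continuous function on an open set whose integrals against all test functions supported in
that set vanish is zero there. -/
theorem eq_zero_of_integral_mul_eq_zero {E : Type*} [NormedAddCommGroup E] [NormedSpace ℝ E]
    [FiniteDimensional ℝ E] [MeasurableSpace E] [BorelSpace E] (μ : Measure E)
    [μ.IsOpenPosMeasure] [IsLocallyFiniteMeasure μ] {s : Set E} (hs : IsOpen s) {g : E → ℂ}
    (hg : Continuous g)
    (h : ∀ ψ : 𝓢(E, ℂ), HasCompactSupport ψ → tsupport ψ ⊆ s → ∫ x, g x * ψ x ∂μ = 0)
    {x : E} (hx : x ∈ s) : g x = 0 := by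
  -- Real-valued test functions already force `g = 0` almost everywhere on `s`; they are viewed as
  -- complex-valued to apply `h`.
  have hae := hs.ae_eq_zero_of_integral_contDiff_smul_eq_zero (μ := μ) (f := g)
    (hg.locallyIntegrable.locallyIntegrableOn s) (fun r hr hrc hrs => by
      have hd : ContDiff ℝ ∞ (fun x => (r x : ℂ)) := Complex.ofRealCLM.contDiff.comp hr
      have hc : HasCompactSupport (fun x => (r x : ℂ)) :=
        hrc.comp_left (g := Complex.ofReal) Complex.ofReal_zero
      have h' := h (hc.toSchwartzMap hd) hc (by
        refine subset_trans (closure_mono fun x hx => ?_) hrs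
        intro h0
        exact hx (by change (r x : ℂ) = 0; simp [h0]))
      rw [← h']
      congr 1 with y
      exact mul_comm _ _)
  -- By continuity the part of `s` where `g ≠ 0` is open, so it would have positive measure if it
  -- were nonempty.
  by_contra hne
  have hopen : IsOpen (s ∩ {y | g y ≠ 0}) := hs.inter (isOpen_ne_fun hg continuous_const)
  have hpos := hopen.measure_pos μ ⟨x, hx, hne⟩
  refine hpos.ne' (measure_mono_null (fun y hy => ?_) hae)
  simp only [Set.mem_compl_iff, Set.mem_ofPred_eq]
  exact fun h => hy.2 (h hy.1)

/-! ### Sheared test functions and their partial Fourier transforms. -/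

/-- The support of `(ξ, η) ↦ φ(ξ + η) ψ(η)` lies in the image of `supp φ × supp ψ` under
`(ζ, η) ↦ (ζ - η, η)`. -/
theorem support_shear_subset (φ ψ : Rn n → ℂ) :
    Function.support (fun p : Rn n × Rn n => φ (p.1 + p.2) * ψ p.2) ⊆
      Set.image (fun q : Rn n × Rn n => (q.1 - q.2, q.2)) (tsupport φ ×ˢ tsupport ψ) := by
  intro p hp
  rw [Function.mem_support, mul_ne_zero_iff] at hp
  exact ⟨(p.1 + p.2, p.2), ⟨subset_tsupport φ hp.1, subset_tsupport ψ hp.2⟩, by simp⟩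

theorem isCompact_shear_image {φ ψ : Rn n → ℂ} (hφ : HasCompactSupport φ)
    (hψ : HasCompactSupport ψ) :
    IsCompact (Set.image (fun q : Rn n × Rn n => (q.1 - q.2, q.2)) (tsupport φ ×ˢ tsupport ψ)) :=
  (hφ.isCompact.prod hψ.isCompact).image (by fun_prop)

theorem hasCompactSupport_shear {φ ψ : Rn n → ℂ} (hφ : HasCompactSupport φ)
    (hψ : HasCompactSupport ψ) :
    HasCompactSupport (fun p : Rn n × Rn n => φ (p.1 + p.2) * ψ p.2) :=
  HasCompactSupport.of_support_subset_isCompact (isCompact_shear_image hφ hψ)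
    (support_shear_subset φ ψ)

/-- The test function `(ξ, η) ↦ φ(ξ + η) ψ(η)`. -/
def shearTensor (φ ψ : 𝓢(Rn n, ℂ)) (hφ : HasCompactSupport φ) (hψ : HasCompactSupport ψ) :
    𝓢(Rn n × Rn n, ℂ) :=
  (hasCompactSupport_shear hφ hψ).toSchwartzMap
    (((φ.smooth ⊤).comp (contDiff_fst.add contDiff_snd)).mul ((ψ.smooth ⊤).comp contDiff_snd))

theorem shearTensor_apply (φ ψ : 𝓢(Rn n, ℂ)) (hφ : HasCompactSupport φ)
    (hψ : HasCompactSupport ψ) (p : Rn n × Rn n) :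
    shearTensor φ ψ hφ hψ p = φ (p.1 + p.2) * ψ p.2 := rfl

theorem hasCompactSupport_shearTensor (φ ψ : 𝓢(Rn n, ℂ)) (hφ : HasCompactSupport φ)
    (hψ : HasCompactSupport ψ) : HasCompactSupport (shearTensor φ ψ hφ hψ) :=
  hasCompactSupport_shear hφ hψ

/-- The image is compact, hence closed, so it also contains the closure of the support. Points of
the support thus appear as `(ζ - η, η)`, the form in which they are compared with `supp b̂`. -/
theorem tsupport_shearTensor_subset (φ ψ : 𝓢(Rn n, ℂ)) (hφ : HasCompactSupport φ)
    (hψ : HasCompactSupport ψ) : tsupport (shearTensor φ ψ hφ hψ) ⊆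
      Set.image (fun q : Rn n × Rn n => (q.1 - q.2, q.2)) (tsupport φ ×ˢ tsupport ψ) :=
  closure_minimal (support_shear_subset φ ψ) (isCompact_shear_image hφ hψ).isClosed

/-- Translating the integration variable by `η` undoes the shear and leaves the factor `e^{i x·η}`,
which is exactly the phase of the pseudo-differential operator in `preTranspose`. -/
theorem partialFourierS_shearTensor (φ ψ : 𝓢(Rn n, ℂ)) (hφ : HasCompactSupport φ)
    (hψ : HasCompactSupport ψ) (p : Rn n × Rn n) :
    partialFourierS (shearTensor φ ψ hφ hψ) p =
      Complex.exp (Complex.I * (inner ℝ p.1 p.2 : ℝ)) * fourierS φ p.1 * ψ p.2 := by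
  rw [partialFourierS_apply, fourierS_apply, ← integral_const_mul, ← integral_mul_const,
    ← integral_sub_right_eq_self _ p.2]
  congr 1 with ξ
  rw [shearTensor_apply, sub_add_cancel, inner_sub_left, real_inner_comm p.1 p.2, ← mul_assoc (Complex.exp _),
    ← mul_assoc (Complex.exp _), ← Complex.exp_add]
  congr 3
  push_cast
  ring

/-! ### The transposed symbol expressed through `b̂`. -/

/-- The pairing of `b̂` with `φ(ξ + η) χ(η) ψ(η)` is, up to a constant, that of the
function `preTranspose b χ φ̂` with `ψ`. -/
theorem integral_preTranspose_mul {b : Rn n × Rn n → ℂ} (hb : IsSymbol b)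
    (χ φ ψ : 𝓢(Rn n, ℂ)) (hφ : HasCompactSupport φ)
    (hψ : HasCompactSupport (SchwartzMap.smulLeftCLM ℂ χ ψ)) :
    ∫ η, preTranspose b χ (fourierS φ) η * ψ η = ((2 * Real.pi : ℂ) ^ n)⁻¹ *
      symbolHat b hb (shearTensor φ (SchwartzMap.smulLeftCLM ℂ χ ψ) hφ hψ) := by
  set f := shearTensor φ (SchwartzMap.smulLeftCLM ℂ χ ψ) hφ hψ
  have h1 : symbolHat b hb f = ∫ p, partialFourierS f p * b p :=
    hb.hasTemperateGrowth.toTemperedDistribution_apply (μ := volume) (partialFourierS f)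
  -- Joint integrability, needed for Fubini, holds because `b` has temperate growth and so maps
  -- Schwartz functions to Schwartz functions by multiplication.
  have hint : Integrable (fun p => partialFourierS f p * b p) (volume.prod volume) := by
    have := (SchwartzMap.smulLeftCLM ℂ b (partialFourierS f)).integrable (μ := volume)
    refine this.congr (.of_forall fun p => ?_)
    simp only [smulLeftCLM_apply_apply hb.hasTemperateGrowth, smul_eq_mul]
    exact mul_comm _ _
  -- The `x`-integral is made the inner one; for each fixed `η` it is the integral defining
  -- `preTranspose`.
  rw [h1, Measure.volume_eq_prod, integral_prod_symm _ hint, ← integral_const_mul]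
  congr 1 with η
  rw [preTranspose_apply hb, mul_assoc, ← integral_mul_const]
  congr 2 with x
  rw [partialFourierS_shearTensor, smulLeftCLM_apply_apply χ.hasTemperateGrowth, smul_eq_mul]
  ring

/-- `preTranspose b χ φ̂` vanishes on an open set `V` if the set of all `(ζ - η, η)` with
`ζ ∈ supp φ` and `η ∈ V` does not meet `supp b̂`. -/
theorem preTranspose_fourierS_eq_zero {b : Rn n × Rn n → ℂ} (hb : IsSymbol b)
    (χ φ : 𝓢(Rn n, ℂ)) (hφ : HasCompactSupport φ) {V : Set (Rn n)} (hV : IsOpen V)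
    (hd : ∀ ζ ∈ tsupport φ, ∀ η ∈ V, (ζ - η, η) ∉ dsupport (symbolHat b hb))
    {η : Rn n} (hη : η ∈ V) : preTranspose b χ (fourierS φ) η = 0 := by
  refine eq_zero_of_integral_mul_eq_zero volume hV
    (preTranspose b χ (fourierS φ)).continuous (fun ψ hψ hψV => ?_) hη
  -- The factor `χ` can only shrink the support, so `χψ` is still supported in `V`.
  have hsub := tsupport_smulLeftCLM_subset (χ : Rn n → ℂ) ψ
  have hc : HasCompactSupport (SchwartzMap.smulLeftCLM ℂ χ ψ) :=
    hψ.of_isClosed_subset (isClosed_tsupport _) (hsub.trans Set.inter_subset_left)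
  rw [integral_preTranspose_mul hb χ φ ψ hφ hc]
  refine mul_eq_zero_of_right _ (apply_eq_zero_of_disjoint_dsupport _ _
    (hasCompactSupport_shearTensor _ _ hφ hc) ?_)
  rw [Set.disjoint_left]
  intro p hp
  obtain ⟨⟨ζ, η⟩, ⟨hζ, hη⟩, rfl⟩ := tsupport_shearTensor_subset _ _ _ _ hp
  exact hd ζ hζ η (hψV (hsub hη).1)

/-! ### Separation of a closed set from a sheared compact set. -/

/-- A point `ζ` that is no sum `ξ + η` with `(ξ, η) ∈ S`, `η ∈ K`, where `S` is closed and `K`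
compact, has a bounded neighbourhood `U` such that the same holds for `U` and a neighbourhood of
`K`. -/
theorem exists_nhds_forall_sub_notMem {S : Set (Rn n × Rn n)} (hS : IsClosed S) {K : Set (Rn n)}
    (hK : IsCompact K) {ζ : Rn n} (h : ∀ η ∈ K, (ζ - η, η) ∉ S) :
    ∃ U V : Set (Rn n), IsOpen U ∧ Bornology.IsBounded U ∧ ζ ∈ U ∧ IsOpen V ∧ K ⊆ V ∧
      ∀ ζ ∈ U, ∀ η ∈ V, (ζ - η, η) ∉ S := by
  have ho : IsOpen ((fun q : Rn n × Rn n => (q.1 - q.2, q.2)) ⁻¹' Sᶜ) :=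
    hS.isOpen_compl.preimage (by fun_prop)
  -- Tube lemma for the compact product `{ζ} × K` inside the open set of pairs `(z, η)` with `(z -
  -- η, η) ∉ S`.
  obtain ⟨U, V, hU, hV, hζ, hKV, hUV⟩ := generalized_tube_lemma (isCompact_singleton (x := ζ)) hK
    ho (by rintro ⟨_, η⟩ ⟨rfl, hη⟩; exact h η hη)
  -- The ball serves only to make the neighbourhood bounded; any radius would do.
  exact ⟨U ∩ Metric.ball ζ 1, V, hU.inter Metric.isOpen_ball,
    Metric.isBounded_ball.subset Set.inter_subset_right,
    ⟨hζ rfl, Metric.mem_ball_self one_pos⟩, hV, hKV,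
    fun z hz η hη => hUV (Set.mk_mem_prod hz.1 hη)⟩

end TypeOneOne

end

/-! ### The support rule. -/

theorem mainTheorem3 (n : ℕ) (b : Rn n × Rn n → ℂ) (hb : TypeOneOne.IsSymbol b)
    (v : 𝓢'(Rn n, ℂ)) (hv : IsCompact (dsupport (TypeOneOne.fourierD v))) :
    dsupport (TypeOneOne.fourierD (TypeOneOne.psiDO b v hv)) ⊆
      {ζ : Rn n | ∃ ξ η : Rn n, (ξ, η) ∈ dsupport (TypeOneOne.symbolHat b hb) ∧
        η ∈ dsupport (TypeOneOne.fourierD v) ∧ ζ = ξ + η} := by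
  intro ζ hζ
  by_contra hmem
  obtain ⟨U, V, hU, hUb, hζU, hV, hKV, hUV⟩ :=
    TypeOneOne.exists_nhds_forall_sub_notMem (ζ := ζ)
      (isClosed_dsupport (f := TypeOneOne.symbolHat b hb)) hv
      fun η hη h => hmem ⟨ζ - η, η, h, hη, by simp⟩
  refine (notMem_dsupport_iff _).2 ⟨U, fun φ hφU => ?_, hU, hζU⟩ hζ
  obtain ⟨χ, hχ⟩ := TypeOneOne.exists_isCutoff hv
  -- Vanishing on `U` is tested with all Schwartz functions supported in `U`; boundedness of `U`
  -- makes their supports compact.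
  have hφ : HasCompactSupport φ :=
    Metric.isCompact_of_isClosed_isBounded (isClosed_tsupport _) (hUb.subset hφU)
  rw [TypeOneOne.psiDO_eq hb hv hχ]
  -- Unfolding the dualities, the outer Fourier transformation falls on `φ`, while the one in the
  -- transposed operator passes to `v`.
  change TypeOneOne.fourierD v (TypeOneOne.preTranspose b χ (TypeOneOne.fourierS φ)) = 0
  refine TypeOneOne.apply_eq_zero_of_disjoint_dsupport _ _ ?_ ?_
  -- The cutoff `χ` is a factor of `preTranspose` in `η`, so the support is compact although `v̂` is
  -- tested with a transform of `φ̂`.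
  · refine HasCompactSupport.intro hχ.hasCompactSupport.isCompact fun ξ h => ?_
    rw [TypeOneOne.preTranspose_apply hb, image_eq_zero_of_notMem_tsupport h]
    simp
  · rw [Set.disjoint_right]
    intro η hη
    rw [notMem_tsupport_iff_eventuallyEq]
    -- Vanishing on the whole open set `V`, and not merely on `supp v̂`, is what keeps the closed
    -- support of the test function off `supp v̂`.
    filter_upwards [hV.mem_nhds (hKV hη)] with ξ hξ
    exact TypeOneOne.preTranspose_fourierS_eq_zero hb χ φ hφ hV
      (fun z hz y hy => hUV z (hφU hz) y hy) hξ
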